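/- Let $d\ge 1$ be an integer and let $|\cdot|$ denote the Euclidean norm on $\mathbb{R}^d$. For $\nu\ge 1/2$ and $\ell>0$ let $$C_{\nu,\ell}(x)=\frac{2^{1-\nu}}{\Gamma(\nu)}\Big(\sqrt{2\nu}\,\frac{|x|}{\ell}\Big)^{\nu}K_\nu\Big(\sqrt{2\nu}\,\frac{|x|}{\ell}\Big)\quad(x\in\mathbb{R}^d\setminus\{0\}),\qquad C_{\nu,\ell}(0)=1,$$ be the Matérn kernel, where $K_\nu$ is the modified Bessel function of the second kind. Write $\hat k(\xi)=\int_{\mathbb{R}^d}k(x)e^{-2\pi i\langle \xi,x\rangle}\,dx$ and $J_m=\{-m,-m+1,\dots,m\}^d$. Let $k=C_{\nu,\ell}$ with $\nu\ge 1/2$ and $0<\ell\le(\log 2)^{-1}\sqrt{\nu/(2d)}$, and let $0<h\le(1+\sqrt{8\nu}\,\ell)^{-1}$. Then $k$ is integrable and the following hold, all the series being absolutely convergent. (i) (Aliasing error.) For every $x\in[-1,1]^d$, $$\Bigg|\sum_{n\in\mathbb{Z}^d,\ n\ne 0}k\Big(x+\frac nh\Big)\Bigg|\le 4d\,3^{d-1}\cdot\frac{2^{1-\nu}}{\Gamma(\nu)}(4\nu)^\nu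 e^{2\nu}K_\nu(4\nu)\cdot e^{-\sqrt{\frac{\nu}{2d}}\,\frac{h^{-1}-1}{\ell}}.$$ (ii) (Truncation error.) For every integer $m\ge 1$ and every $x\in\mathbb{R}^d$, $$\Bigg|h^d\sum_{j\in\mathbb{Z}^d,\ j\notin J_m}\hat k(jh)\,e^{2\pi i h\langle j,x\rangle}\Bigg|\le\frac{\nu^{\nu-1}d\,5^{d-1}}{2^\nu\pi^{d/2+2\nu}}\,\frac{\Gamma(\nu+1/2)}{\Gamma(\nu)}\,\frac1{(h\ell m)^{2\nu}},$$ and the same bound also holds with $\Gamma(\nu+d/2)$ in place of $\Gamma(\nu+1/2)$. -/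

import Mathlib

open scoped FourierTransform

/-- The modified Bessel function of the second kind `K_ν(z)`, for real order `ν` and `z > 0`:
`K_ν(z) = ∫_0^∞ exp(-z cosh t) cosh(ν t) dt`. -/
noncomputable def besselK (ν z : ℝ) : ℝ :=
  ∫ t in Set.Ioi (0 : ℝ), Real.exp (-z * Real.cosh t) * Real.cosh (ν * t)

/-- The Matérn kernel `C_{ν,ℓ}` on `ℝ^d`. At the origin the formula is read as its limit `1`. -/
noncomputable def matern {d : ℕ} (ν ℓ : ℝ) (x : EuclideanSpace ℝ (Fin d)) : ℝ :=
  open Classical in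
  if x = 0 then 1
  else 2 ^ (1 - ν) / Real.Gamma ν * (Real.sqrt (2 * ν) * (‖x‖ / ℓ)) ^ ν
    * besselK ν (Real.sqrt (2 * ν) * (‖x‖ / ℓ))

/-- The Fourier transform `ξ ↦ ∫ C_{ν,ℓ}(x) exp(-2πi⟨ξ,x⟩) dx` of the Matérn kernel. -/
noncomputable def maternHat {d : ℕ} (ν ℓ : ℝ) : EuclideanSpace ℝ (Fin d) → ℂ :=
  𝓕 (fun x : EuclideanSpace ℝ (Fin d) => (matern ν ℓ x : ℂ))

/-- The integer multi-index `n ∈ ℤ^d` as a point of `ℝ^d`. -/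
def latticePoint {d : ℕ} (n : Fin d → ℤ) : EuclideanSpace ℝ (Fin d) :=
  WithLp.toLp 2 (fun i => (n i : ℝ))

/-- The index box `J_m = {-m, …, m}^d`. -/
def indexBox (d m : ℕ) : Set (Fin d → ℤ) :=
  {j | ∀ i, -(m : ℤ) ≤ j i ∧ j i ≤ (m : ℤ)}

/-- The term of index `n` of the aliasing sum, `C_{ν,ℓ}(x + n/h)`. -/
noncomputable def aliasTerm {d : ℕ} (ν ℓ h : ℝ) (x : EuclideanSpace ℝ (Fin d))
    (n : Fin d → ℤ) : ℝ :=
  matern ν ℓ (x + h⁻¹ • latticePoint n)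

/-- The term of index `j` of the truncation sum, `Ĉ_{ν,ℓ}(jh) exp(2πi h⟨j,x⟩)`. -/
noncomputable def truncTerm {d : ℕ} (ν ℓ h : ℝ) (x : EuclideanSpace ℝ (Fin d))
    (j : Fin d → ℤ) : ℂ :=
  maternHat ν ℓ (h • latticePoint j)
    * Complex.exp (2 * Real.pi * Complex.I * h * (inner ℝ (latticePoint j) x : ℝ))

/-!
The Matérn kernel is a Gamma mixture of Gaussians, so its Fourier transform is explicit: a constant
times `(1 + 2π²ℓ²|ξ|²/ν) ^ (-(ν + d/2))`.

Aliasing: `z ^ ν * exp (z / 2) * K_ν(z)` decreases for `z ≥ 2ν`, and its value at `z = 4ν` gives the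
constant. Since `|x|₁ ≤ √d |x|`, the resulting exponential decay is dominated by a product over the
coordinates. A nonzero index has a nonzero coordinate, whose geometric series contributes
`4 exp (-c (1/h - 1))` with `c = √(ν/(2d))/ℓ`, and each of the other coordinates contributes at
most `3`.

Truncation: an index outside the box has a coordinate exceeding `m`. The other coordinates are
summed out one at a time. Each such sum turns `A ^ (-(a + 1/2))` into `A ^ (-a)`; it is compared
with an integral by writing the inverse power as a Gamma integral, and costs a factor `5`, or
`5 Γ(a) / Γ(a + 1/2)` when `√a ≤ (5 - √π) √A`, a condition ensured by the upper bounds on `ℓ` and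
`h`. The Gamma quotients telescope. The remaining one-dimensional tail is bounded by
`∫_m^∞ 2 x ^ (-(2ν + 1)) dx = m ^ (-2ν) / ν`.
-/

open MeasureTheory Set Real
open Module (finrank)
open scoped ENNReal

/-! ### The Matérn kernel as a mixture of Gaussians -/

lemma integrableOn_rpow_mul_exp_neg_mul {a b : ℝ} (ha : 0 < a) (hb : 0 < b) :
    IntegrableOn (fun t : ℝ => t ^ (a - 1) * exp (-(b * t))) (Ioi 0) := by
  simpa only [rpow_one, neg_mul] using
    integrableOn_rpow_mul_exp_neg_mul_rpow (by linarith : -1 < a - 1) one_pos hb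

lemma sq_div_two_le_cosh (t : ℝ) : t ^ 2 / 2 ≤ cosh t := by
  have half_le_sinh : |t / 2| ≤ sinh |t / 2| := self_le_sinh_iff.2 (abs_nonneg _)
  have sq_le_sq : (t / 2) ^ 2 ≤ sinh (t / 2) ^ 2 := by
    rw [sq_le_sq, abs_sinh]
    exact half_le_sinh
  have cosh_eq : cosh t = 1 + 2 * sinh (t / 2) ^ 2 := by
    rw [← mul_div_cancel₀ t (two_ne_zero' ℝ), cosh_two_mul, cosh_sq]
    ring_nf
  linarith

lemma integrable_exp_neg_mul_cosh_mul_exp (ν : ℝ) {z : ℝ} (hz : 0 < z) :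
    Integrable fun t => exp (-z * cosh t) * exp (ν * t) := by
  have gaussian := integrable_cexp_quadratic' (b := (-(z / 2) : ℝ)) (by simpa using hz) ν 0
  refine gaussian.norm.mono' (by fun_prop) (.of_forall fun t => ?_)
  rw [norm_of_nonneg (by positivity), ← exp_add, Complex.norm_exp]
  refine exp_le_exp.2 ?_
  have : (((-(z / 2) : ℝ) : ℂ) * t ^ 2 + ν * t + 0).re = -(z * (t ^ 2 / 2)) + ν * t := by
    norm_cast
    ring
  rw [this, neg_mul]
  gcongr
  exact sq_div_two_le_cosh t

lemma two_mul_besselK (ν : ℝ) {z : ℝ} (hz : 0 < z) :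
    2 * besselK ν z = ∫ t, exp (-z * cosh t) * exp (ν * t) := by
  have cosh_eq_half : ∀ t : ℝ, exp (-z * cosh |t|) * cosh (ν * |t|)
      = (exp (-z * cosh t) * exp (ν * t) + exp (-z * cosh t) * exp (-ν * t)) / 2 := by
    intro t
    rw [cosh_abs, ← cosh_abs (ν * |t|), abs_mul, abs_abs, ← abs_mul, cosh_abs, cosh_eq (ν * t),
      neg_mul ν t]
    ring
  have reflect : ∫ t, exp (-z * cosh t) * exp (-ν * t) = ∫ t, exp (-z * cosh t) * exp (ν * t) := by
    rw [← integral_neg_eq_self]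
    simp only [cosh_neg, neg_mul, mul_neg, neg_neg]
  rw [besselK, ← integral_comp_abs (f := fun t => exp (-z * cosh t) * cosh (ν * t))]
  simp_rw [cosh_eq_half]
  rw [integral_div, integral_add (integrable_exp_neg_mul_cosh_mul_exp ν hz)
    (integrable_exp_neg_mul_cosh_mul_exp (-ν) hz), reflect]
  ring

lemma image_mul_exp_univ {c : ℝ} (hc : 0 < c) : (fun t => c * exp t) '' univ = Ioi (0 : ℝ) := by
  rw [← image_image (c * ·) exp, image_univ, range_exp, image_mul_left_Ioi hc, mul_zero]

lemma integral_rpow_mul_exp_neg_sub_div (ν : ℝ) {z : ℝ} (hz : 0 < z) :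
    ∫ u in Ioi (0 : ℝ), u ^ (ν - 1) * exp (-u - (z / 2) ^ 2 / u)
      = 2 * (z / 2) ^ ν * besselK ν z := by
  have substitution := integral_image_eq_integral_abs_deriv_smul (s := univ)
    (f := fun t => z / 2 * exp t) (f' := fun t => z / 2 * exp t) MeasurableSet.univ
    (fun t _ => ((hasDerivAt_exp t).const_mul (z / 2)).hasDerivWithinAt)
    (fun x _ y _ hxy => by simpa [hz.ne'] using hxy)
    (fun u => u ^ (ν - 1) * exp (-u - (z / 2) ^ 2 / u))
  rw [image_mul_exp_univ (half_pos hz), Measure.restrict_univ] at substitution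
  rw [substitution, mul_right_comm, two_mul_besselK ν hz, mul_comm, ← integral_const_mul]
  congr 1 with t
  have exponent : -(z / 2 * exp t) - (z / 2) ^ 2 / (z / 2 * exp t) = -z * cosh t := by
    rw [cosh_eq, exp_neg]
    field_simp
    ring
  have pos : 0 < z / 2 * exp t := by positivity
  rw [exponent, abs_of_pos pos, smul_eq_mul, rpow_sub_one pos.ne',
    mul_rpow (half_pos hz).le (exp_pos t).le, ← exp_mul, mul_comm t ν]
  field_simp

/-- The density in `t` of a mixture of the centred Gaussians `exp (-(b / t) * ‖x‖ ^ 2)`, with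
Gamma(`ν`) mixing weights left unnormalised. For `b = ν / (2 * ℓ ^ 2)` its integral over `t > 0`
is `Γ(ν) C_{ν,ℓ}(x)`. -/
noncomputable def gammaGaussian {V : Type*} [Norm V] (ν b : ℝ) (x : V) (t : ℝ) : ℝ :=
  t ^ (ν - 1) * exp (-t) * exp (-(b / t) * ‖x‖ ^ 2)

lemma matern_eq_integral {d : ℕ} {ν ℓ : ℝ} (hν : 0 < ν) (hℓ : 0 < ℓ)
    (x : EuclideanSpace ℝ (Fin d)) :
    matern ν ℓ x = (Gamma ν)⁻¹ * ∫ t in Ioi (0 : ℝ), gammaGaussian ν (ν / (2 * ℓ ^ 2)) x t := by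
  have Gamma_ne : Gamma ν ≠ 0 := (Gamma_pos_of_pos hν).ne'
  unfold matern gammaGaussian
  split_ifs with hx
  · have : ∫ t in Ioi (0 : ℝ), t ^ (ν - 1) * exp (-t) = Gamma ν := by
      simp_rw [Gamma_eq_integral hν, mul_comm]
    simpa [hx, this] using (inv_mul_cancel₀ Gamma_ne).symm
  · have : 0 < ‖x‖ := norm_pos_iff.2 hx
    set z := √(2 * ν) * (‖x‖ / ℓ) with hz
    have z_pos : 0 < z := by positivity
    have z_sq : z ^ 2 = 2 * ν * (‖x‖ / ℓ) ^ 2 := by rw [hz, mul_pow, sq_sqrt (by positivity)]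
    have integrand_eq : ∀ t ∈ Ioi (0 : ℝ),
        t ^ (ν - 1) * exp (-t) * exp (-(ν / (2 * ℓ ^ 2) / t) * ‖x‖ ^ 2)
          = t ^ (ν - 1) * exp (-t - (z / 2) ^ 2 / t) := by
      intro t ht
      have : t ≠ 0 := ht.ne'
      rw [mul_assoc, ← exp_add, div_pow, z_sq]
      congr 2
      field_simp
      ring
    rw [setIntegral_congr_fun measurableSet_Ioi integrand_eq,
      integral_rpow_mul_exp_neg_sub_div ν z_pos, div_rpow z_pos.le zero_le_two,
      rpow_sub zero_lt_two, rpow_one]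
    field_simp

/-! ### Integrability and Fourier transform -/

section Fourier

variable {V : Type*} [NormedAddCommGroup V] [InnerProductSpace ℝ V] [FiniteDimensional ℝ V]
  [MeasurableSpace V] [BorelSpace V] {ν b : ℝ}

lemma integral_gammaGaussian (hb : 0 < b) {t : ℝ} (ht : 0 < t) :
    ∫ x : V, gammaGaussian ν b x t
      = (π / b) ^ (finrank ℝ V / 2 : ℝ) * (t ^ (ν + finrank ℝ V / 2 - 1) * exp (-t)) := by
  simp only [gammaGaussian]
  rw [integral_const_mul, GaussianFourier.integral_rexp_neg_mul_sq_norm (div_pos hb ht),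
    div_div_eq_mul_div, mul_div_right_comm, mul_rpow (by positivity) ht.le, add_sub_right_comm,
    rpow_add ht]
  ring

lemma integrable_gammaGaussian (hν : 0 < ν) (hb : 0 < b) :
    Integrable (Function.uncurry (gammaGaussian ν b : V → ℝ → ℝ))
      (volume.prod (volume.restrict (Ioi 0))) := by
  have measurable : Measurable (Function.uncurry (gammaGaussian ν b : V → ℝ → ℝ)) := by
    unfold gammaGaussian
    fun_prop
  rw [integrable_prod_iff' measurable.aestronglyMeasurable]
  constructor
  · filter_upwards [ae_restrict_mem measurableSet_Ioi] with t (ht : 0 < t)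
    have gaussian := GaussianFourier.integrable_cexp_neg_mul_sq_norm_add (V := V)
      (b := (b / t : ℝ)) (by simpa only [Complex.ofReal_re] using div_pos hb ht) 0 0
    refine (gaussian.norm.congr (.of_forall fun x => ?_)).const_mul (t ^ (ν - 1) * exp (-t))
    simp [Complex.norm_exp, ← Complex.ofReal_pow]
  · have gamma : IntegrableOn (fun t => t ^ (ν + finrank ℝ V / 2 - 1) * exp (-t)) (Ioi 0) := by
      simpa only [one_mul] using integrableOn_rpow_mul_exp_neg_mul (by positivity) one_pos
    refine (gamma.const_mul ((π / b) ^ (finrank ℝ V / 2 : ℝ))).congr ?_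
    filter_upwards [ae_restrict_mem measurableSet_Ioi] with t (ht : 0 < t)
    rw [← integral_gammaGaussian hb ht]
    congr 1 with x
    exact (norm_of_nonneg (by unfold gammaGaussian; positivity)).symm

lemma fourier_const_mul (c : ℂ) (f : V → ℂ) (ξ : V) :
    𝓕 (fun x => c * f x) ξ = c * 𝓕 f ξ :=
  congrFun (VectorFourier.fourierIntegral_const_smul 𝐞 volume (innerₗ V) f c) ξ

lemma fourier_gammaGaussian (hb : 0 < b) {t : ℝ} (ht : 0 < t) (ξ : V) :
    𝓕 (fun x : V => (gammaGaussian ν b x t : ℂ)) ξ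
      = (((π / b) ^ (finrank ℝ V / 2 : ℝ)
          * (t ^ (ν + finrank ℝ V / 2 - 1) * exp (-((1 + π ^ 2 / b * ‖ξ‖ ^ 2) * t))) : ℝ) : ℂ) := by
  have gaussian := fourier_gaussian_innerProductSpace (V := V)
    (b := (b / t : ℝ)) (by simpa only [Complex.ofReal_re] using div_pos hb ht) ξ
  have constant : (π / ((b / t : ℝ) : ℂ)) ^ (finrank ℝ V / 2 : ℂ)
      = (((π / b) ^ (finrank ℝ V / 2 : ℝ) * t ^ (finrank ℝ V / 2 : ℝ) : ℝ) : ℂ) := by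
    rw [← mul_rpow (by positivity) ht.le, Complex.ofReal_cpow (by positivity)]
    push_cast
    congr 1
    field_simp
  have exponential : Complex.exp (-π ^ 2 * ‖ξ‖ ^ 2 / ((b / t : ℝ) : ℂ))
      = ((exp (-(π ^ 2 / b * ‖ξ‖ ^ 2 * t)) : ℝ) : ℂ) := by
    push_cast
    congr 1
    field_simp
  have slice : ∀ x : V, (gammaGaussian ν b x t : ℂ) = ((t ^ (ν - 1) * exp (-t) : ℝ) : ℂ)
      * Complex.exp (-((b / t : ℝ) : ℂ) * ‖x‖ ^ 2) := by
    intro x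
    simp [gammaGaussian]
  simp_rw [slice]
  rw [fourier_const_mul, gaussian, constant, exponential, add_sub_right_comm, rpow_add ht,
    add_mul, one_mul, neg_add, exp_add]
  push_cast
  ring

lemma fourier_integral_eq_integral_fourier {T : Type*} [MeasurableSpace T] {μ : Measure T}
    [SFinite μ] {F : V → T → ℂ} (hF : Integrable (Function.uncurry F) (volume.prod μ)) (ξ : V) :
    𝓕 (fun x => ∫ t, F x t ∂μ) ξ = ∫ t, 𝓕 (fun x => F x t) ξ ∂μ := by
  have integrable_mul_char : Integrable
      (Function.uncurry fun x t => Complex.exp (↑(-2 * π * inner ℝ x ξ) * Complex.I) • F x t)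
      (volume.prod μ) := by
    refine hF.bdd_mul (c := 1) (by fun_prop) (.of_forall fun p => ?_)
    rw [Complex.norm_exp_ofReal_mul_I]
  simp only [Real.fourier_eq', ← integral_smul]
  exact integral_integral_swap integrable_mul_char

lemma fourier_integral_gammaGaussian (hν : 0 < ν) (hb : 0 < b) (ξ : V) :
    𝓕 (fun x : V => ((∫ t in Ioi (0 : ℝ), gammaGaussian ν b x t : ℝ) : ℂ)) ξ
      = (((π / b) ^ (finrank ℝ V / 2 : ℝ) * Gamma (ν + finrank ℝ V / 2)
          * (1 + π ^ 2 / b * ‖ξ‖ ^ 2) ^ (-(ν + finrank ℝ V / 2)) : ℝ) : ℂ) := by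
  simp only [← integral_complex_ofReal]
  rw [fourier_integral_eq_integral_fourier (integrable_gammaGaussian hν hb).ofReal,
    setIntegral_congr_fun measurableSet_Ioi fun t ht => fourier_gammaGaussian hb ht ξ,
    integral_complex_ofReal, integral_const_mul,
    integral_rpow_mul_exp_neg_mul_Ioi (by positivity) (by positivity), one_div,
    inv_rpow (by positivity), ← rpow_neg (by positivity)]
  congr 1
  ring

end Fourier

section MaternFourier

variable {d : ℕ} {ν ℓ : ℝ}

lemma integrable_matern (hν : 0 < ν) (hℓ : 0 < ℓ) :
    Integrable fun x : EuclideanSpace ℝ (Fin d) => (matern ν ℓ x : ℂ) := by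
  simp_rw [matern_eq_integral hν hℓ]
  exact ((integrable_gammaGaussian hν (by positivity)).integral_prod_left.const_mul _).ofReal

lemma maternHat_eq (hν : 0 < ν) (hℓ : 0 < ℓ) (ξ : EuclideanSpace ℝ (Fin d)) :
    maternHat ν ℓ ξ = ((Gamma (ν + d / 2) / Gamma ν * (2 * π * ℓ ^ 2 / ν) ^ ((d : ℝ) / 2)
      * (1 + 2 * π ^ 2 * ℓ ^ 2 / ν * ‖ξ‖ ^ 2) ^ (-(ν + d / 2)) : ℝ) : ℂ) := by
  have b_pos : 0 < ν / (2 * ℓ ^ 2) := by positivity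
  have kernel : ∀ x : EuclideanSpace ℝ (Fin d), (matern ν ℓ x : ℂ) = ((Gamma ν)⁻¹ : ℝ)
      * ((∫ t in Ioi (0 : ℝ), gammaGaussian ν (ν / (2 * ℓ ^ 2)) x t : ℝ) : ℂ) := by
    intro x
    rw [matern_eq_integral hν hℓ, Complex.ofReal_mul]
  have covariance_inv : π ^ 2 / (ν / (2 * ℓ ^ 2)) = 2 * π ^ 2 * ℓ ^ 2 / ν := by field_simp
  have determinant : π / (ν / (2 * ℓ ^ 2)) = 2 * π * ℓ ^ 2 / ν := by field_simp
  simp_rw [maternHat, kernel]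
  rw [fourier_const_mul, fourier_integral_gammaGaussian hν b_pos, finrank_euclideanSpace_fin,
    covariance_inv, determinant, ← Complex.ofReal_mul]
  congr 1
  ring

end MaternFourier

/-! ### Decay of the Matérn kernel -/

lemma besselK_nonneg (ν z : ℝ) : 0 ≤ besselK ν z :=
  integral_nonneg fun _ => mul_nonneg (exp_pos _).le (cosh_pos _).le

lemma integrable_exp_neg_mul_cosh_mul_cosh (ν : ℝ) {z : ℝ} (hz : 0 < z) :
    Integrable fun t => exp (-z * cosh t) * cosh (ν * t) := by
  refine (((integrable_exp_neg_mul_cosh_mul_exp ν hz).add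
    (integrable_exp_neg_mul_cosh_mul_exp (-ν) hz)).div_const 2).congr (.of_forall fun t => ?_)
  simp only [Pi.add_apply, cosh_eq (ν * t), neg_mul]
  ring

lemma antitoneOn_rpow_mul_exp_neg {a c : ℝ} (ha : 0 < a) (hc : 0 < c) :
    AntitoneOn (fun z : ℝ => z ^ a * exp (-(c * z))) (Ici (a / c)) := by
  intro w (hw : a / c ≤ w) z _ hwz
  have w_pos : 0 < w := (div_pos ha hc).trans_le hw
  have z_pos : 0 < z := w_pos.trans_le hwz
  have ratio_le : (z / w) ^ a ≤ exp (c * z - c * w) := by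
    calc (z / w) ^ a ≤ exp (z / w - 1) ^ a := by
          gcongr
          linarith [add_one_le_exp (z / w - 1)]
      _ = exp (a / w * (z - w)) := by
          rw [← exp_mul]
          congr 1
          field_simp
      _ ≤ exp (c * (z - w)) := by
          have : a / w ≤ c := (div_le_comm₀ hc w_pos).1 hw
          have : 0 ≤ z - w := sub_nonneg.2 hwz
          gcongr
      _ = exp (c * z - c * w) := by rw [mul_sub]
  rw [div_rpow z_pos.le w_pos.le, div_le_iff₀ (by positivity), exp_sub] at ratio_le
  simp only [exp_neg]
  rw [← div_eq_mul_inv, ← div_eq_mul_inv, div_le_div_iff₀ (exp_pos _) (exp_pos _)]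
  rwa [div_mul_eq_mul_div, le_div_iff₀ (exp_pos _), mul_comm (exp _)] at ratio_le

lemma antitoneOn_rpow_mul_exp_mul_besselK (μ : ℝ) {a c : ℝ} (ha : 0 < a) (hc : 0 < c) :
    AntitoneOn (fun z : ℝ => z ^ a * exp ((1 - c) * z) * besselK μ z) (Ici (a / c)) := by
  intro w hw z hz hwz
  have w_pos : 0 < w := (div_pos ha hc).trans_le hw
  have z_pos : 0 < z := w_pos.trans_le hwz
  simp only [besselK, ← integral_const_mul]
  refine integral_mono
    ((integrable_exp_neg_mul_cosh_mul_cosh μ z_pos).integrableOn.const_mul _)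
    ((integrable_exp_neg_mul_cosh_mul_cosh μ w_pos).integrableOn.const_mul _) fun t => ?_
  have split_exp : ∀ y : ℝ, y ^ a * exp ((1 - c) * y) * (exp (-y * cosh t) * cosh (μ * t))
      = y ^ a * exp (-(c * y)) * (exp (-(y * (cosh t - 1))) * cosh (μ * t)) := by
    intro y
    have : exp ((1 - c) * y) * exp (-y * cosh t) = exp (-(c * y)) * exp (-(y * (cosh t - 1))) := by
      rw [← exp_add, ← exp_add]
      ring_nf
    linear_combination y ^ a * cosh (μ * t) * this
  have : 0 ≤ cosh t - 1 := sub_nonneg.2 (one_le_cosh t)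
  have : 0 ≤ cosh (μ * t) := (cosh_pos _).le
  simp only [split_exp]
  exact mul_le_mul (antitoneOn_rpow_mul_exp_neg ha hc hw hz hwz) (by gcongr) (by positivity)
    (by positivity)

lemma sum_abs_le_sqrt_mul_norm {ι : Type*} [Fintype ι] (x : EuclideanSpace ℝ ι) :
    ∑ i, |x i| ≤ √(Fintype.card ι) * ‖x‖ := by
  rw [← sqrt_sq (norm_nonneg x), ← sqrt_mul (Nat.cast_nonneg _), EuclideanSpace.real_norm_sq_eq]
  refine le_sqrt_of_sq_le ?_
  simpa using sq_sum_le_card_mul_sum_sq (s := Finset.univ) (f := fun i => |x i|)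

section MaternDecay

variable {d : ℕ} {ν ℓ : ℝ}

lemma matern_nonneg (hν : 0 < ν) (hℓ : 0 < ℓ) (x : EuclideanSpace ℝ (Fin d)) :
    0 ≤ matern ν ℓ x := by
  rw [matern_eq_integral hν hℓ]
  refine mul_nonneg (inv_nonneg.2 (Gamma_pos_of_pos hν).le)
    (setIntegral_nonneg measurableSet_Ioi fun t (ht : 0 < t) => ?_)
  unfold gammaGaussian
  positivity

/-- The prefactor in the exponential decay of the Matérn kernel: up to the normalisation of the
kernel it is the value of `z ^ ν * exp (z / 2) * K_ν(z)` at `z = 4ν`. -/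
noncomputable def maternDecayConst (ν : ℝ) : ℝ :=
  2 ^ (1 - ν) / Gamma ν * (4 * ν) ^ ν * exp (2 * ν) * besselK ν (4 * ν)

lemma maternDecayConst_nonneg (hν : 0 < ν) : 0 ≤ maternDecayConst ν := by
  have : 0 ≤ besselK ν (4 * ν) := besselK_nonneg _ _
  have : 0 < Gamma ν := Gamma_pos_of_pos hν
  unfold maternDecayConst
  positivity

lemma matern_le_exp_neg_norm (hν : 0 < ν) (hℓ : 0 < ℓ) {x : EuclideanSpace ℝ (Fin d)}
    (hx : √(8 * ν) * ℓ ≤ ‖x‖) :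
    matern ν ℓ x ≤ maternDecayConst ν * exp (-(√(ν / 2) / ℓ * ‖x‖)) := by
  have : 0 < Gamma ν := Gamma_pos_of_pos hν
  have norm_pos : 0 < ‖x‖ := lt_of_lt_of_le (by positivity) hx
  rw [matern, if_neg (norm_pos_iff.1 norm_pos)]
  set z := √(2 * ν) * (‖x‖ / ℓ) with hz
  have four_mul_le : 4 * ν ≤ z := by
    calc 4 * ν = √(2 * ν) * √(8 * ν) := by
          rw [← sqrt_mul (by positivity), show 2 * ν * (8 * ν) = (4 * ν) ^ 2 by ring,
            sqrt_sq (by positivity)]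
      _ ≤ z := by
          rw [hz]
          gcongr
          rwa [le_div_iff₀ hℓ]
  have exponent : √(ν / 2) / ℓ * ‖x‖ = z / 2 := by
    rw [hz, show 2 * ν = 2 ^ 2 * (ν / 2) by ring, sqrt_mul (by positivity), sqrt_sq zero_le_two]
    ring
  have antitone := antitoneOn_rpow_mul_exp_mul_besselK ν hν (one_half_pos (α := ℝ))
    (show ν / (1 / 2) ≤ 4 * ν by linarith) (show ν / (1 / 2) ≤ z by linarith) four_mul_le
  simp only [show (1 - 1 / 2 : ℝ) * (4 * ν) = 2 * ν by ring] at antitone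
  rw [exponent]
  calc 2 ^ (1 - ν) / Gamma ν * z ^ ν * besselK ν z
      = 2 ^ (1 - ν) / Gamma ν * (z ^ ν * exp ((1 - 1 / 2) * z) * besselK ν z)
        * exp (-(z / 2)) := by
        have : exp ((1 - 1 / 2) * z) * exp (-(z / 2)) = 1 := by
          rw [← exp_add, exp_eq_one_iff]
          ring
        linear_combination -(2 ^ (1 - ν) / Gamma ν * z ^ ν * besselK ν z) * this
    _ ≤ 2 ^ (1 - ν) / Gamma ν * ((4 * ν) ^ ν * exp (2 * ν) * besselK ν (4 * ν))
        * exp (-(z / 2)) := by gcongr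
    _ = maternDecayConst ν * exp (-(z / 2)) := by
        rw [maternDecayConst]
        ring

lemma matern_le_prod_exp_neg_abs (hν : 0 < ν) (hℓ : 0 < ℓ) {x : EuclideanSpace ℝ (Fin d)}
    (hx : √(8 * ν) * ℓ ≤ ‖x‖) :
    matern ν ℓ x ≤ maternDecayConst ν * ∏ i, exp (-(√(ν / (2 * d)) / ℓ * |x i|)) := by
  have rate_le : √(ν / (2 * d)) * √d ≤ √(ν / 2) := by
    rw [← sqrt_mul (by positivity), ← div_div]
    refine sqrt_le_sqrt ?_
    rw [div_mul_eq_mul_div, mul_div_assoc]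
    exact mul_le_of_le_one_right (by positivity) (div_self_le_one _)
  have exponent_le : ∑ i, √(ν / (2 * d)) / ℓ * |x i| ≤ √(ν / 2) / ℓ * ‖x‖ := by
    calc ∑ i, √(ν / (2 * d)) / ℓ * |x i| = √(ν / (2 * d)) / ℓ * ∑ i, |x i| :=
          (Finset.mul_sum ..).symm
      _ ≤ √(ν / (2 * d)) / ℓ * (√d * ‖x‖) := by
          gcongr
          simpa using sum_abs_le_sqrt_mul_norm x
      _ = √(ν / (2 * d)) * √d / ℓ * ‖x‖ := by ring
      _ ≤ √(ν / 2) / ℓ * ‖x‖ := by gcongr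
  refine (matern_le_exp_neg_norm hν hℓ hx).trans ?_
  rw [← exp_sum, Finset.sum_neg_distrib]
  have : 0 ≤ maternDecayConst ν := maternDecayConst_nonneg hν
  gcongr

end MaternDecay

/-! ### Sums of nonnegative functions over lattices -/

lemma summable_and_norm_tsum_le {ι E : Type*} [NormedAddCommGroup E] [CompleteSpace E]
    {f : ι → E} {B : ℝ} (hB : 0 ≤ B) (h : ∑' i, ENNReal.ofReal ‖f i‖ ≤ ENNReal.ofReal B) :
    Summable f ∧ ‖∑' i, f i‖ ≤ B := by
  have summable_norm : Summable fun i => ‖f i‖ := by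
    simpa using ENNReal.summable_toReal (h.trans_lt ENNReal.ofReal_lt_top).ne
  refine ⟨summable_norm.of_norm, (norm_tsum_le_tsum_norm summable_norm).trans ?_⟩
  rwa [← ENNReal.ofReal_tsum_of_nonneg (fun _ => norm_nonneg _) summable_norm,
    ENNReal.ofReal_le_ofReal_iff hB] at h

section Pi

variable {α : Type*} {n : ℕ}

lemma tsum_pi_succ (i : Fin (n + 1)) (f : (Fin (n + 1) → α) → ℝ≥0∞) :
    ∑' j, f j = ∑' r : α, ∑' j : Fin n → α, f (i.insertNth r j) := by
  rw [← (Fin.insertNthEquiv (fun _ => α) i).tsum_eq f, ENNReal.tsum_prod']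
  rfl

lemma tsum_pi_prod (g : Fin n → α → ℝ≥0∞) :
    ∑' j : Fin n → α, ∏ i, g i (j i) = ∏ i, ∑' r, g i r := by
  induction n with
  | zero => simp
  | succ n ih =>
    rw [tsum_pi_succ 0, Fin.prod_univ_succ]
    simp only [Fin.prod_univ_succ, Fin.insertNth_zero', Fin.cons_zero, Fin.cons_succ,
      ENNReal.tsum_mul_left, ENNReal.tsum_mul_right, ih fun i => g i.succ]

lemma tsum_subtype_le_sum_insertNth {S : (Fin (n + 1) → α) → Prop} {P : α → Prop}
    (hS : ∀ j, S j → ∃ i, P (j i)) (f : (Fin (n + 1) → α) → ℝ≥0∞) :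
    ∑' j : {j // S j}, f j
      ≤ ∑ i : Fin (n + 1), ∑' r : {r // P r}, ∑' j : Fin n → α, f (i.insertNth r.1 j) := by
  classical
  have sum_insertNth : ∀ i : Fin (n + 1),
      ∑' r : {r // P r}, ∑' j : Fin n → α, f (i.insertNth r.1 j)
        = ∑' j : Fin (n + 1) → α, if P (j i) then f j else 0 := by
    intro i
    rw [tsum_pi_succ i]
    refine (tsum_subtype {r | P r} fun r => ∑' j : Fin n → α, f (i.insertNth r j)).trans
      (tsum_congr fun r => ?_)
    by_cases hr : P r <;> simp [hr]
  simp_rw [sum_insertNth]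
  rw [← Summable.tsum_finsetSum fun _ _ => ENNReal.summable]
  refine (tsum_subtype {j | S j} f).trans_le (ENNReal.tsum_le_tsum fun j => ?_)
  refine indicator_apply_le' (fun hj => ?_) fun _ => zero_le
  obtain ⟨i, hi⟩ := hS j hj
  calc f j = if P (j i) then f j else 0 := (if_pos hi).symm
    _ ≤ ∑ i, if P (j i) then f j else 0 :=
      Finset.single_le_sum (f := fun i => if P (j i) then f j else 0) (fun _ _ => zero_le)
        (Finset.mem_univ i)

lemma tsum_subtype_prod_le {S : (Fin (n + 1) → α) → Prop} {P : α → Prop}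
    (hS : ∀ j, S j → ∃ i, P (j i)) {g : Fin (n + 1) → α → ℝ≥0∞} {a b : ℝ≥0∞}
    (ha : ∀ i, ∑' r : {r // P r}, g i r ≤ a) (hb : ∀ i, ∑' r, g i r ≤ b) :
    ∑' j : {j // S j}, ∏ i, g i (j.1 i) ≤ (n + 1) * (a * b ^ n) := by
  have sum_le : ∀ i : Fin (n + 1), ∑' r : {r // P r}, ∑' j : Fin n → α,
      ∏ k, g k ((i.insertNth r.1 j : Fin (n + 1) → α) k) ≤ a * b ^ n := by
    intro i
    simp only [Fin.prod_univ_succAbove _ i, Fin.insertNth_apply_same,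
      Fin.insertNth_apply_succAbove, ENNReal.tsum_mul_left, ENNReal.tsum_mul_right,
      tsum_pi_prod fun k => g (i.succAbove k)]
    gcongr
    · exact ha i
    · simpa using Finset.prod_le_pow_card Finset.univ _ b fun k _ => hb (i.succAbove k)
  calc _ ≤ _ := tsum_subtype_le_sum_insertNth hS fun j => ∏ i, g i (j i)
    _ ≤ ∑ _i : Fin (n + 1), a * b ^ n := Finset.sum_le_sum fun i _ => sum_le i
    _ = (n + 1) * (a * b ^ n) := by simp

end Pi

lemma tsum_int_natCast_lt_abs (m : ℕ) (f : ℤ → ℝ≥0∞) :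
    ∑' r : {r : ℤ // m < |r|}, f r
      = ∑' n : ℕ, f (n + m + 1 : ℕ) + ∑' n : ℕ, f (-(n + m + 1 : ℕ)) := by
  have injective_pos : Function.Injective fun n : ℕ => ((n + m + 1 : ℕ) : ℤ) :=
    fun a b h => by simpa using h
  have injective_neg : Function.Injective fun n : ℕ => -((n + m + 1 : ℕ) : ℤ) :=
    neg_injective.comp injective_pos
  have union : {r : ℤ | m < |r|} = range (fun n : ℕ => ((n + m + 1 : ℕ) : ℤ))
      ∪ range (fun n : ℕ => -((n + m + 1 : ℕ) : ℤ)) := by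
    ext r
    simp only [mem_ofPred_eq, lt_abs, mem_union, mem_range]
    refine or_congr ⟨fun h => ⟨(r - m - 1).toNat, by omega⟩, ?_⟩
      ⟨fun h => ⟨(-r - m - 1).toNat, by omega⟩, ?_⟩ <;> rintro ⟨n, rfl⟩ <;> omega
  have disjoint : Disjoint (range fun n : ℕ => ((n + m + 1 : ℕ) : ℤ))
      (range fun n : ℕ => -((n + m + 1 : ℕ) : ℤ)) := by
    rw [disjoint_left]
    rintro _ ⟨a, rfl⟩ ⟨b, hb⟩
    simp only at hb
    omega
  change ∑' r : ({r : ℤ | m < |r|} : Set ℤ), f r = _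
  rw [union, Summable.tsum_union_disjoint disjoint ENNReal.summable ENNReal.summable,
    tsum_range f injective_pos, tsum_range f injective_neg]

/-! ### The aliasing error -/

lemma exp_neg_le_half {y : ℝ} (hy : log 2 ≤ y) : exp (-y) ≤ 1 / 2 := by
  rw [one_div, ← exp_log (zero_lt_two' ℝ), ← exp_neg]
  gcongr

lemma tsum_exp_neg_add_natCast_mul {c : ℝ} (T y : ℝ) (hc : 0 < c * T) :
    ∑' n : ℕ, ENNReal.ofReal (exp (-(c * (y + n * T))))
      = ENNReal.ofReal (exp (-(c * y)) / (1 - exp (-(c * T)))) := by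
  have geometric : ∀ n : ℕ, exp (-(c * (y + n * T))) = exp (-(c * y)) * exp (-(c * T)) ^ n := by
    intro n
    rw [← exp_nat_mul, ← exp_add]
    ring_nf
  have ratio_lt : exp (-(c * T)) < 1 := exp_lt_one_iff.2 (neg_neg_of_pos hc)
  simp_rw [geometric]
  rw [← ENNReal.ofReal_tsum_of_nonneg (fun n => by positivity)
    ((summable_geometric_of_lt_one (exp_pos _).le ratio_lt).mul_left _), tsum_mul_left,
    tsum_geometric_of_lt_one (exp_pos _).le ratio_lt, div_eq_mul_inv]

section Periodization

variable {c T : ℝ} (hT : 0 < T) (hc : log 2 ≤ c * T)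

include hT hc

lemma tsum_int_exp_neg_abs_le_of_mem_Ico {y : ℝ} (hy : y ∈ Ico 0 T) :
    ∑' r : ℤ, ENNReal.ofReal (exp (-(c * |y + r * T|))) ≤ 3 := by
  have cT_pos : 0 < c * T := (log_pos one_lt_two).trans_le hc
  have half : exp (-(c * T)) ≤ 1 / 2 := exp_neg_le_half hc
  have abs_right : ∀ n : ℕ, |y + ((n : ℤ) : ℝ) * T| = y + n * T := by
    intro n
    rw [Int.cast_natCast, abs_of_nonneg (add_nonneg hy.1 (by positivity))]
  have abs_left : ∀ n : ℕ, |y + ((-((n : ℤ) + 1) : ℤ) : ℝ) * T| = T - y + n * T := by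
    intro n
    rw [← abs_neg, ← abs_of_nonneg (add_nonneg (sub_nonneg.2 hy.2.le) (by positivity))]
    push_cast
    ring_nf
  have endpoints : exp (-(c * y)) + exp (-(c * (T - y))) ≤ 1 + exp (-(c * T)) := by
    have product : exp (-(c * T)) = exp (-(c * y)) * exp (-(c * (T - y))) := by
      rw [← exp_add]
      ring_nf
    have left_le : exp (-(c * y)) ≤ 1 := exp_le_one_iff.2 (by nlinarith [hy.1])
    have right_le : exp (-(c * (T - y))) ≤ 1 := exp_le_one_iff.2 (by nlinarith [hy.2])
    rw [product]
    nlinarith [mul_nonneg (sub_nonneg.2 left_le) (sub_nonneg.2 right_le)]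
  rw [tsum_of_nat_of_neg_add_one ENNReal.summable ENNReal.summable]
  simp_rw [abs_right, abs_left]
  rw [tsum_exp_neg_add_natCast_mul T y cT_pos, tsum_exp_neg_add_natCast_mul T (T - y) cT_pos,
    ← ENNReal.ofReal_add (div_nonneg (by positivity) (by linarith))
      (div_nonneg (by positivity) (by linarith)), ← add_div, ← ENNReal.ofReal_ofNat 3]
  refine ENNReal.ofReal_le_ofReal ?_
  rw [div_le_iff₀ (by linarith)]
  linarith

lemma tsum_int_exp_neg_abs_le (x : ℝ) :
    ∑' r : ℤ, ENNReal.ofReal (exp (-(c * |x + r * T|))) ≤ 3 := by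
  obtain ⟨k, hk, -⟩ := existsUnique_sub_zsmul_mem_Ico hT x 0
  rw [zero_add, zsmul_eq_mul] at hk
  refine le_trans (le_of_eq ?_) (tsum_int_exp_neg_abs_le_of_mem_Ico hT hc hk)
  rw [← (Equiv.subRight k).tsum_eq]
  refine tsum_congr fun r => ?_
  rw [Equiv.subRight_apply, Int.cast_sub, sub_mul, add_sub, sub_add_eq_add_sub]

lemma tsum_int_ne_zero_exp_neg_abs_le {x : ℝ} (hx : |x| ≤ 1) :
    ∑' r : {r : ℤ // 0 < |r|}, ENNReal.ofReal (exp (-(c * |x + r * T|)))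
      ≤ ENNReal.ofReal (4 * exp (-(c * (T - 1)))) := by
  have cT_pos : 0 < c * T := (log_pos one_lt_two).trans_le hc
  have c_pos : 0 < c := pos_of_mul_pos_left cT_pos hT.le
  have half : exp (-(c * T)) ≤ 1 / 2 := exp_neg_le_half hc
  have one_sided : ∀ f : ℕ → ℝ, (∀ n : ℕ, T - 1 + n * T ≤ f n) →
      ∑' n, ENNReal.ofReal (exp (-(c * f n))) ≤ ENNReal.ofReal (2 * exp (-(c * (T - 1)))) := by
    intro f hf
    calc ∑' n, ENNReal.ofReal (exp (-(c * f n)))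
        ≤ ∑' n : ℕ, ENNReal.ofReal (exp (-(c * (T - 1 + n * T)))) := by
          gcongr with n
          exact hf n
      _ = ENNReal.ofReal (exp (-(c * (T - 1))) / (1 - exp (-(c * T)))) :=
          tsum_exp_neg_add_natCast_mul T (T - 1) cT_pos
      _ ≤ ENNReal.ofReal (2 * exp (-(c * (T - 1)))) := by
          refine ENNReal.ofReal_le_ofReal ?_
          rw [div_le_iff₀ (by linarith)]
          nlinarith [exp_pos (-(c * (T - 1)))]
  have two_sided := tsum_int_natCast_lt_abs 0
    fun r => ENNReal.ofReal (exp (-(c * |x + r * T|)))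
  rw [Nat.cast_zero] at two_sided
  rw [two_sided, show (4 : ℝ) = 2 + 2 by norm_num, add_mul,
    ENNReal.ofReal_add (by positivity) (by positivity)]
  obtain ⟨x_ge, x_le⟩ := abs_le.1 hx
  refine add_le_add (one_sided _ fun n => le_abs.2 (.inl ?_))
    (one_sided _ fun n => le_abs.2 (.inr ?_))
  all_goals
    push_cast
    linarith

lemma tsum_ne_zero_prod_exp_neg_abs_le {n : ℕ} {x : Fin (n + 1) → ℝ} (hx : ∀ i, |x i| ≤ 1) :
    ∑' j : {j : Fin (n + 1) → ℤ // j ≠ 0}, ∏ i, ENNReal.ofReal (exp (-(c * |x i + j.1 i * T|)))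
      ≤ ENNReal.ofReal ((n + 1) * (4 * exp (-(c * (T - 1))) * 3 ^ n)) := by
  refine (tsum_subtype_prod_le (P := fun r => 0 < |r|) (fun j hj => ?_)
    (fun i => tsum_int_ne_zero_exp_neg_abs_le hT hc (hx i))
    (fun i => tsum_int_exp_neg_abs_le hT hc (x i))).trans_eq ?_
  · simpa only [abs_pos, Pi.zero_apply] using Function.ne_iff.1 hj
  · rw [ENNReal.ofReal_mul (p := (n : ℝ) + 1) (by positivity),
      ENNReal.ofReal_mul (q := 3 ^ n) (by positivity), ENNReal.ofReal_pow (by positivity),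
      ENNReal.ofReal_ofNat, ← Nat.cast_succ, ← Nat.cast_succ, ENNReal.ofReal_natCast]

end Periodization

lemma sub_one_le_norm_add_smul_latticePoint {d : ℕ} {T : ℝ} (hT : 0 ≤ T)
    {x : EuclideanSpace ℝ (Fin d)} (hx : ∀ i, |x i| ≤ 1) {j : Fin d → ℤ} (hj : j ≠ 0) :
    T - 1 ≤ ‖x + T • latticePoint j‖ := by
  obtain ⟨i, hi⟩ := Function.ne_iff.1 hj
  have one_le : (1 : ℝ) ≤ |(j i : ℝ)| := by exact_mod_cast Int.one_le_abs hi
  calc T - 1 ≤ |T * j i| - |x i| := by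
        rw [abs_mul, abs_of_nonneg hT]
        nlinarith [hx i]
    _ ≤ |x i + T * j i| := by
        rw [add_comm]
        exact abs_sub_abs_le_abs_add _ _
    _ = ‖(x + T • latticePoint j) i‖ := rfl
    _ ≤ ‖x + T • latticePoint j‖ := PiLp.norm_apply_le _ i

lemma aliasTerm_summable_and_abs_tsum_le {n : ℕ} {ν ℓ h : ℝ} (hν : 0 < ν) (hℓ : 0 < ℓ)
    (hh : 1 + √(8 * ν) * ℓ ≤ h⁻¹) (hlog : log 2 ≤ √(ν / (2 * (n + 1 : ℕ))) / ℓ)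
    {x : EuclideanSpace ℝ (Fin (n + 1))} (hx : ∀ i, |x i| ≤ 1) :
    Summable (fun j : {j : Fin (n + 1) → ℤ // j ≠ 0} => aliasTerm ν ℓ h x j) ∧
      |∑' j : {j : Fin (n + 1) → ℤ // j ≠ 0}, aliasTerm ν ℓ h x j|
        ≤ maternDecayConst ν
          * ((n + 1) * (4 * exp (-(√(ν / (2 * (n + 1 : ℕ))) / ℓ * (h⁻¹ - 1))) * 3 ^ n)) := by
  set c := √(ν / (2 * (n + 1 : ℕ))) / ℓ
  have const_nonneg : 0 ≤ maternDecayConst ν := maternDecayConst_nonneg hν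
  have one_le : 1 ≤ h⁻¹ := le_trans (le_add_of_nonneg_right (by positivity)) hh
  have term_le : ∀ j : {j : Fin (n + 1) → ℤ // j ≠ 0}, ENNReal.ofReal ‖aliasTerm ν ℓ h x j‖
      ≤ ENNReal.ofReal (maternDecayConst ν)
        * ∏ i, ENNReal.ofReal (exp (-(c * |x i + j.1 i * h⁻¹|))) := by
    rintro ⟨j, hj⟩
    have far : √(8 * ν) * ℓ ≤ ‖x + h⁻¹ • latticePoint j‖ := by
      linarith [sub_one_le_norm_add_smul_latticePoint (zero_le_one.trans one_le) hx hj]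
    rw [← ENNReal.ofReal_prod_of_nonneg fun _ _ => (exp_pos _).le,
      ← ENNReal.ofReal_mul const_nonneg, aliasTerm, norm_of_nonneg (matern_nonneg hν hℓ _)]
    refine ENNReal.ofReal_le_ofReal ((matern_le_prod_exp_neg_abs hν hℓ far).trans_eq ?_)
    simp [c, latticePoint, mul_comm]
  refine summable_and_norm_tsum_le (by positivity) ((ENNReal.tsum_le_tsum term_le).trans ?_)
  rw [ENNReal.tsum_mul_left, ENNReal.ofReal_mul const_nonneg]
  gcongr
  refine tsum_ne_zero_prod_exp_neg_abs_le (by linarith) (hlog.trans ?_) hx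
  exact le_mul_of_one_le_right (by positivity) one_le

/-! ### One-dimensional sums of inverse powers -/

lemma tsum_ofReal_comp_add_le_integral {f : ℝ → ℝ} (m : ℕ) (anti : AntitoneOn f (Ici m))
    (int : IntegrableOn f (Ioi m)) (nonneg : ∀ x ∈ Ioi (m : ℝ), 0 ≤ f x) :
    ∑' n : ℕ, ENNReal.ofReal (f (n + m + 1 : ℕ)) ≤ ENNReal.ofReal (∫ x in Ioi (m : ℝ), f x) := by
  have summable := (summable_nat_add_iff (m + 1)).2 (anti.summable_of_integrableOn_Ioi int nonneg)
  simp only [← add_assoc] at summable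
  rw [← ENNReal.ofReal_tsum_of_nonneg (fun n => nonneg _ (mem_Ioi.2 (by norm_cast; omega)))
    summable]
  exact ENNReal.ofReal_le_ofReal (anti.tsum_comp_add_le_integral m int nonneg)

lemma tsum_exp_neg_mul_sq_le {t : ℝ} (ht : 0 < t) :
    ∑' n : ℕ, ENNReal.ofReal (exp (-t * (n + 1) ^ 2)) ≤ ENNReal.ofReal (√(π / t) / 2) := by
  have bound := tsum_ofReal_comp_add_le_integral (f := fun x => exp (-t * x ^ 2)) 0 ?_
    (integrable_exp_neg_mul_sq ht).integrableOn fun _ _ => (exp_pos _).le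
  · rw [Nat.cast_zero, integral_gaussian_Ioi] at bound
    simpa using bound
  · intro x hx y _ hxy
    have x_nonneg : 0 ≤ x := by simpa using hx
    simp only [neg_mul]
    gcongr

lemma tsum_rpow_neg_two_mul_add_one_le {ν : ℝ} (hν : 0 < ν) {m : ℕ} (hm : 1 ≤ m) :
    ∑' n : ℕ, ENNReal.ofReal (((n + m + 1 : ℕ) : ℝ) ^ (-(2 * ν + 1)))
      ≤ ENNReal.ofReal ((m : ℝ) ^ (-(2 * ν)) / (2 * ν)) := by
  have m_pos : (0 : ℝ) < m := Nat.cast_pos.2 hm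
  refine (tsum_ofReal_comp_add_le_integral (f := fun x => x ^ (-(2 * ν + 1))) m
    (fun x hx y _ hxy => rpow_le_rpow_of_nonpos (m_pos.trans_le hx) hxy (by linarith))
    (integrableOn_Ioi_rpow_of_lt (by linarith) m_pos)
    fun x hx => rpow_nonneg (m_pos.trans hx).le _).trans_eq ?_
  rw [integral_Ioi_rpow_of_lt (by linarith) m_pos, neg_add, neg_add_cancel_right, neg_div_neg_eq]

lemma tsum_int_natCast_lt_abs_rpow_neg_le {ν A : ℝ} (hν : 0 < ν) (hA : 0 ≤ A) {m : ℕ}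
    (hm : 1 ≤ m) :
    ∑' r : {r : ℤ // m < |r|}, ENNReal.ofReal ((A + (r : ℝ) ^ 2) ^ (-(ν + 1 / 2)))
      ≤ ENNReal.ofReal ((m : ℝ) ^ (-(2 * ν)) / ν) := by
  have one_sided : ∑' n : ℕ, ENNReal.ofReal ((A + ((n + m + 1 : ℕ) : ℝ) ^ 2) ^ (-(ν + 1 / 2)))
      ≤ ENNReal.ofReal ((m : ℝ) ^ (-(2 * ν)) / (2 * ν)) := by
    refine (ENNReal.tsum_le_tsum fun n => ENNReal.ofReal_le_ofReal ?_).trans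
      (tsum_rpow_neg_two_mul_add_one_le hν hm)
    rw [show -(2 * ν + 1) = 2 * -(ν + 1 / 2) by ring, rpow_mul (Nat.cast_nonneg _), rpow_two]
    exact rpow_le_rpow_of_nonpos (by positivity) (le_add_of_nonneg_left hA) (by linarith)
  rw [tsum_int_natCast_lt_abs m fun r => ENNReal.ofReal ((A + (r : ℝ) ^ 2) ^ (-(ν + 1 / 2)))]
  simp only [Int.cast_neg, Int.cast_natCast, neg_sq]
  refine (add_le_add one_sided one_sided).trans_eq ?_
  rw [← ENNReal.ofReal_add (by positivity) (by positivity)]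
  ring_nf

lemma ofReal_rpow_neg_mul_Gamma {a b : ℝ} (ha : 0 < a) (hb : 0 < b) :
    ENNReal.ofReal (b ^ (-a)) * ENNReal.ofReal (Gamma a)
      = ∫⁻ t in Ioi (0 : ℝ), ENNReal.ofReal (t ^ (a - 1) * exp (-(b * t))) := by
  rw [← ofReal_integral_eq_lintegral_ofReal (integrableOn_rpow_mul_exp_neg_mul ha hb),
    integral_rpow_mul_exp_neg_mul_Ioi ha hb, ← ENNReal.ofReal_mul (by positivity), one_div,
    inv_rpow hb.le, rpow_neg hb.le]
  filter_upwards [ae_restrict_mem measurableSet_Ioi] with t ht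
  exact mul_nonneg (rpow_nonneg (mem_Ioi.1 ht).le _) (exp_pos _).le

lemma tsum_rpow_mul_exp_neg_mul_le {a A t : ℝ} (ht : 0 < t) :
    ∑' n : ℕ, ENNReal.ofReal (t ^ (a + 1 / 2 - 1) * exp (-((A + (n + 1) ^ 2) * t)))
      ≤ ENNReal.ofReal (√π / 2) * ENNReal.ofReal (t ^ (a - 1) * exp (-(A * t))) := by
  have split : ∀ n : ℕ, t ^ (a + 1 / 2 - 1) * exp (-((A + (n + 1) ^ 2) * t))
      = t ^ (a + 1 / 2 - 1) * exp (-(A * t)) * exp (-t * (n + 1) ^ 2) := by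
    intro n
    rw [mul_assoc, ← exp_add]
    ring_nf
  simp_rw [split, ENNReal.ofReal_mul (mul_nonneg (rpow_nonneg ht.le (a + 1 / 2 - 1))
    (exp_pos (-(A * t))).le), ENNReal.tsum_mul_left]
  grw [tsum_exp_neg_mul_sq_le ht]
  rw [← ENNReal.ofReal_mul (by positivity), ← ENNReal.ofReal_mul (by positivity),
    sqrt_div pi_pos.le, add_sub_right_comm, rpow_add ht, ← sqrt_eq_rpow]
  field_simp
  rfl

lemma tsum_nat_rpow_neg_le {a A : ℝ} (ha : 0 < a) (hA : 0 < A) :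
    ∑' n : ℕ, ENNReal.ofReal ((A + (n + 1) ^ 2) ^ (-(a + 1 / 2)))
      ≤ ENNReal.ofReal (√π / 2 * (Gamma a / Gamma (a + 1 / 2)) * A ^ (-a)) := by
  have Gamma_half_pos : 0 < Gamma (a + 1 / 2) := Gamma_pos_of_pos (by linarith)
  rw [← ENNReal.mul_le_mul_iff_left (ENNReal.ofReal_pos.2 Gamma_half_pos).ne'
    ENNReal.ofReal_ne_top, ← ENNReal.tsum_mul_right]
  calc ∑' n : ℕ, ENNReal.ofReal ((A + (n + 1) ^ 2) ^ (-(a + 1 / 2)))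
        * ENNReal.ofReal (Gamma (a + 1 / 2))
      = ∫⁻ t in Ioi (0 : ℝ), ∑' n : ℕ,
          ENNReal.ofReal (t ^ (a + 1 / 2 - 1) * exp (-((A + (n + 1) ^ 2) * t))) := by
        rw [lintegral_tsum fun n => by fun_prop]
        exact tsum_congr fun n => ofReal_rpow_neg_mul_Gamma (by linarith) (by positivity)
    _ ≤ ∫⁻ t in Ioi (0 : ℝ),
          ENNReal.ofReal (√π / 2) * ENNReal.ofReal (t ^ (a - 1) * exp (-(A * t))) :=
        setLIntegral_mono' measurableSet_Ioi fun t ht => tsum_rpow_mul_exp_neg_mul_le ht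
    _ = ENNReal.ofReal (√π / 2 * (Gamma a / Gamma (a + 1 / 2)) * A ^ (-a))
          * ENNReal.ofReal (Gamma (a + 1 / 2)) := by
        rw [lintegral_const_mul' _ _ ENNReal.ofReal_ne_top, ← ofReal_rpow_neg_mul_Gamma ha hA,
          ← ENNReal.ofReal_mul (by positivity), ← ENNReal.ofReal_mul (by positivity),
          ← ENNReal.ofReal_mul (by positivity)]
        field_simp

lemma tsum_int_rpow_neg_le {a A : ℝ} (ha : 0 < a) (hA : 0 < A) :
    ∑' r : ℤ, ENNReal.ofReal ((A + (r : ℝ) ^ 2) ^ (-(a + 1 / 2)))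
      ≤ ENNReal.ofReal
          (A ^ (-(a + 1 / 2)) + √π * (Gamma a / Gamma (a + 1 / 2)) * A ^ (-a)) := by
  have one_sided := tsum_nat_rpow_neg_le ha hA
  have half_nonneg : 0 ≤ √π / 2 * (Gamma a / Gamma (a + 1 / 2)) * A ^ (-a) := by positivity
  rw [tsum_of_add_one_of_neg_add_one ENNReal.summable ENNReal.summable]
  push_cast
  simp only [neg_sq]
  refine (add_le_add_three one_sided le_rfl one_sided).trans_eq ?_
  rw [zero_pow two_ne_zero, add_zero,
    ← ENNReal.ofReal_add half_nonneg (by positivity),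
    ← ENNReal.ofReal_add (by positivity) half_nonneg]
  ring_nf

lemma tsum_int_rpow_neg_le_five_mul {a A : ℝ} (ha : 1 / 2 ≤ a) (hA : 1 ≤ A) :
    ∑' r : ℤ, ENNReal.ofReal ((A + (r : ℝ) ^ 2) ^ (-(a + 1 / 2)))
      ≤ ENNReal.ofReal (5 * A ^ (-a)) := by
  have A_pos : 0 < A := one_pos.trans_le hA
  have term_le : ∀ r : ℤ, (A + (r : ℝ) ^ 2) ^ (-(a + 1 / 2))
      ≤ A ^ (-(a - 1 / 2)) * (A + (r : ℝ) ^ 2) ^ (-(1 / 2 + 1 / 2 : ℝ)) := by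
    intro r
    rw [show -(a + 1 / 2) = -(a - 1 / 2) + -(1 / 2 + 1 / 2 : ℝ) by ring,
      rpow_add (by positivity)]
    gcongr ?_ * _
    exact rpow_le_rpow_of_nonpos A_pos (le_add_of_nonneg_right (sq_nonneg _)) (by linarith)
  have exponent_one : A ^ (-(1 / 2 + 1 / 2) : ℝ)
      + √π * (Gamma (1 / 2) / Gamma (1 / 2 + 1 / 2)) * A ^ (-(1 / 2) : ℝ)
        ≤ 5 * A ^ (-(1 / 2) : ℝ) := by
    have le_half : A ^ (-(1 / 2 + 1 / 2) : ℝ) ≤ A ^ (-(1 / 2) : ℝ) :=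
      rpow_le_rpow_of_exponent_le hA (by norm_num)
    rw [Gamma_one_half_eq, add_halves, Gamma_one, div_one, mul_self_sqrt pi_pos.le]
    rw [add_halves] at le_half
    nlinarith [pi_le_four, rpow_pos_of_pos A_pos (-(1 / 2))]
  calc ∑' r : ℤ, ENNReal.ofReal ((A + (r : ℝ) ^ 2) ^ (-(a + 1 / 2)))
      ≤ ∑' r : ℤ, ENNReal.ofReal (A ^ (-(a - 1 / 2)))
          * ENNReal.ofReal ((A + (r : ℝ) ^ 2) ^ (-(1 / 2 + 1 / 2 : ℝ))) := by
        simp only [← ENNReal.ofReal_mul (rpow_pos_of_pos A_pos _).le]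
        gcongr with r
        exact term_le r
    _ ≤ ENNReal.ofReal (A ^ (-(a - 1 / 2))) * ENNReal.ofReal (5 * A ^ (-(1 / 2) : ℝ)) := by
        rw [ENNReal.tsum_mul_left]
        gcongr
        exact (tsum_int_rpow_neg_le one_half_pos A_pos).trans
          (ENNReal.ofReal_le_ofReal exponent_one)
    _ = ENNReal.ofReal (5 * A ^ (-a)) := by
        rw [← ENNReal.ofReal_mul (by positivity), mul_left_comm, ← rpow_add A_pos]
        ring_nf

lemma Gamma_add_half_le_sqrt_mul_Gamma {a : ℝ} (ha : 0 < a) :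
    Gamma (a + 1 / 2) ≤ √a * Gamma a := by
  have log_convex := Gamma_mul_add_mul_le_rpow_Gamma_mul_rpow_Gamma ha (t := a + 1)
    (by linarith) one_half_pos one_half_pos (add_halves 1)
  have Gamma_nonneg : 0 ≤ Gamma a := (Gamma_pos_of_pos ha).le
  calc Gamma (a + 1 / 2) = Gamma (1 / 2 * a + 1 / 2 * (a + 1)) := by ring_nf
    _ ≤ √(Gamma a) * √(a * Gamma a) := by
        rwa [Gamma_add_one ha.ne', ← sqrt_eq_rpow, ← sqrt_eq_rpow] at log_convex
    _ = √a * Gamma a := by rw [sqrt_mul ha.le, mul_left_comm, mul_self_sqrt Gamma_nonneg]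

lemma tsum_int_rpow_neg_le_five_mul_Gamma_div {a A : ℝ} (ha : 0 < a) (hA : 0 < A)
    (haA : √a ≤ (5 - √π) * √A) :
    ∑' r : ℤ, ENNReal.ofReal ((A + (r : ℝ) ^ 2) ^ (-(a + 1 / 2)))
      ≤ ENNReal.ofReal (5 * (Gamma a / Gamma (a + 1 / 2)) * A ^ (-a)) := by
  refine (tsum_int_rpow_neg_le ha hA).trans (ENNReal.ofReal_le_ofReal ?_)
  have Gamma_half_pos : 0 < Gamma (a + 1 / 2) := Gamma_pos_of_pos (by linarith)
  have one_le : 1 ≤ (5 - √π) * (Gamma a / Gamma (a + 1 / 2)) * √A := by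
    rw [mul_div_assoc', div_mul_eq_mul_div, le_div_iff₀ Gamma_half_pos, one_mul]
    calc Gamma (a + 1 / 2) ≤ √a * Gamma a := Gamma_add_half_le_sqrt_mul_Gamma ha
      _ ≤ (5 - √π) * √A * Gamma a := by gcongr
      _ = (5 - √π) * Gamma a * √A := by ring
  have rpow_split : A ^ (-a) = A ^ (-(a + 1 / 2)) * √A := by
    rw [sqrt_eq_rpow, ← rpow_add hA]
    ring_nf
  rw [rpow_split]
  nlinarith [rpow_pos_of_pos hA (-(a + 1 / 2))]

/-! ### Lattice sums of inverse powers -/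

section CoordinatewiseSummation

variable {φ : ℕ → ℝ → ℝ≥0∞} {c : ℕ → ℝ≥0∞} {n : ℕ} {A₀ : ℝ}

lemma tsum_pi_sum_sq_le
    (step : ∀ k < n, ∀ A, A₀ ≤ A → ∑' r : ℤ, φ (k + 1) (A + r ^ 2) ≤ c k * φ k A)
    {A : ℝ} (hA : A₀ ≤ A) :
    ∑' j : Fin n → ℤ, φ n (A + ∑ i, (j i : ℝ) ^ 2) ≤ (∏ k ∈ Finset.range n, c k) * φ 0 A := by
  induction n with
  | zero => simp
  | succ n ih =>
    have sum_last : ∀ j : Fin n → ℤ, ∑' r : ℤ, φ (n + 1) (A + (r ^ 2 + ∑ i, (j i : ℝ) ^ 2))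
        ≤ c n * φ n (A + ∑ i, (j i : ℝ) ^ 2) := by
      intro j
      have shift_le : A₀ ≤ A + ∑ i, (j i : ℝ) ^ 2 :=
        le_add_of_le_of_nonneg hA (Finset.sum_nonneg fun _ _ => sq_nonneg _)
      simpa only [add_right_comm, ← add_assoc] using step n n.lt_succ_self _ shift_le
    rw [tsum_pi_succ 0, ENNReal.tsum_comm]
    simp only [Fin.sum_univ_succ, Fin.insertNth_zero', Fin.cons_zero, Fin.cons_succ]
    calc ∑' j : Fin n → ℤ, ∑' r : ℤ, φ (n + 1) (A + (r ^ 2 + ∑ i, (j i : ℝ) ^ 2))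
        ≤ ∑' j : Fin n → ℤ, c n * φ n (A + ∑ i, (j i : ℝ) ^ 2) := ENNReal.tsum_le_tsum sum_last
      _ ≤ c n * ((∏ k ∈ Finset.range n, c k) * φ 0 A) := by
          rw [ENNReal.tsum_mul_left]
          gcongr
          exact ih fun k hk => step k (hk.trans n.lt_succ_self)
      _ = (∏ k ∈ Finset.range (n + 1), c k) * φ 0 A := by
          rw [Finset.prod_range_succ, ← mul_assoc, mul_comm (c n)]

lemma exists_natCast_lt_abs_of_notMem_indexBox {d m : ℕ} {j : Fin d → ℤ}
    (hj : j ∉ indexBox d m) : ∃ i, (m : ℤ) < |j i| := by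
  contrapose! hj
  exact fun i => abs_le.1 (hj i)

/-- A point outside the box has a coordinate that exceeds `m`; that coordinate is summed last, and
since its square is at least `1` the other sums only meet shifts that are at least `A₀ + 1`. -/
lemma tsum_notMem_indexBox_le
    (step : ∀ k < n, ∀ A, A₀ + 1 ≤ A → ∑' r : ℤ, φ (k + 1) (A + r ^ 2) ≤ c k * φ k A) (m : ℕ) :
    ∑' j : {j : Fin (n + 1) → ℤ // j ∉ indexBox (n + 1) m}, φ n (A₀ + ∑ i, (j.1 i : ℝ) ^ 2)
      ≤ (n + 1) * ((∏ k ∈ Finset.range n, c k)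
        * ∑' r : {r : ℤ // m < |r|}, φ 0 (A₀ + (r : ℝ) ^ 2)) := by
  have one_le_sq : ∀ r : {r : ℤ // m < |r|}, (1 : ℝ) ≤ (r : ℝ) ^ 2 := by
    rintro ⟨r, hr⟩
    exact_mod_cast (one_le_sq_iff_one_le_abs r).2 (by omega)
  have sum_le : ∀ i : Fin (n + 1), ∑' r : {r : ℤ // m < |r|}, ∑' j : Fin n → ℤ,
      φ n (A₀ + ∑ k, ((i.insertNth r.1 j : Fin (n + 1) → ℤ) k : ℝ) ^ 2)
      ≤ (∏ k ∈ Finset.range n, c k) * ∑' r : {r : ℤ // m < |r|}, φ 0 (A₀ + (r : ℝ) ^ 2) := by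
    intro i
    simp only [Fin.sum_univ_succAbove _ i, Fin.insertNth_apply_same,
      Fin.insertNth_apply_succAbove, ← add_assoc, ← ENNReal.tsum_mul_left]
    exact ENNReal.tsum_le_tsum fun r => tsum_pi_sum_sq_le step (by linarith [one_le_sq r])
  calc _ ≤ _ := tsum_subtype_le_sum_insertNth
        (fun _ => exists_natCast_lt_abs_of_notMem_indexBox)
        fun j : Fin (n + 1) → ℤ => φ n (A₀ + ∑ i, (j i : ℝ) ^ 2)
    _ ≤ _ := Finset.sum_le_sum fun i _ => sum_le i
    _ = _ := by simp

end CoordinatewiseSummation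

lemma tsum_notMem_indexBox_rpow_neg_le_of_step {n : ℕ} {ν A₀ : ℝ} (hν : 0 < ν) (hA₀ : 0 ≤ A₀)
    {g : ℕ → ℝ} (hg : ∀ k, 0 < g k)
    (step : ∀ k < n, ∀ A, A₀ + 1 ≤ A →
      ∑' r : ℤ, ENNReal.ofReal ((A + (r : ℝ) ^ 2) ^ (-(ν + (k + 1 : ℕ) / 2 + 1 / 2)))
        ≤ ENNReal.ofReal (5 * (g k / g (k + 1)) * A ^ (-(ν + (k + 1 : ℕ) / 2))))
    {m : ℕ} (hm : 1 ≤ m) :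
    ∑' j : {j : Fin (n + 1) → ℤ // j ∉ indexBox (n + 1) m},
        ENNReal.ofReal ((A₀ + ∑ i, (j.1 i : ℝ) ^ 2) ^ (-(ν + (n + 1 : ℕ) / 2)))
      ≤ ENNReal.ofReal ((n + 1) * (5 ^ n * (g 0 / g n)) * ((m : ℝ) ^ (-(2 * ν)) / ν)) := by
  have ratio_nonneg : ∀ k, 0 ≤ 5 * (g k / g (k + 1)) := fun k =>
    mul_nonneg (by norm_num) (div_pos (hg k) (hg _)).le
  have telescope : ∏ k ∈ Finset.range n, ENNReal.ofReal (5 * (g k / g (k + 1)))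
      = ENNReal.ofReal (5 ^ n * (g 0 / g n)) := by
    rw [← ENNReal.ofReal_prod_of_nonneg fun k _ => ratio_nonneg k]
    congr 1
    refine Finset.prod_range_induction _ (fun n => 5 ^ n * (g 0 / g n)) ?_ n fun k _ => ?_
    · rw [pow_zero, div_self (hg 0).ne', one_mul]
    · field_simp [(hg k).ne', (hg (k + 1)).ne']
      ring
  have lattice := tsum_notMem_indexBox_le
    (φ := fun k A => ENNReal.ofReal (A ^ (-(ν + (k + 1 : ℕ) / 2))))
    (c := fun k => ENNReal.ofReal (5 * (g k / g (k + 1)))) (n := n) (A₀ := A₀)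
    (fun k hk A hA => ?_) m
  · refine lattice.trans ?_
    rw [telescope, zero_add, Nat.cast_one]
    grw [tsum_int_natCast_lt_abs_rpow_neg_le hν hA₀ hm]
    rw [← ENNReal.ofReal_mul (mul_nonneg (by positivity) (div_pos (hg 0) (hg n)).le),
      mul_assoc ((n : ℝ) + 1), ENNReal.ofReal_mul (p := (n : ℝ) + 1) (by positivity),
      ← Nat.cast_succ, ← Nat.cast_succ, ENNReal.ofReal_natCast]
  · rw [← ENNReal.ofReal_mul (ratio_nonneg k)]
    refine Eq.trans_le ?_ (step k hk A hA)
    push_cast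
    ring_nf

lemma tsum_notMem_indexBox_rpow_neg_le {n : ℕ} {ν A₀ : ℝ} (hν : 0 < ν) (hA₀ : 0 ≤ A₀) {m : ℕ}
    (hm : 1 ≤ m) :
    ∑' j : {j : Fin (n + 1) → ℤ // j ∉ indexBox (n + 1) m},
        ENNReal.ofReal ((A₀ + ∑ i, (j.1 i : ℝ) ^ 2) ^ (-(ν + (n + 1 : ℕ) / 2)))
      ≤ ENNReal.ofReal ((n + 1) * 5 ^ n * ((m : ℝ) ^ (-(2 * ν)) / ν)) := by
  have bound := tsum_notMem_indexBox_rpow_neg_le_of_step (n := n) hν hA₀ (g := fun _ => 1)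
    (fun _ => one_pos) (fun k _ A hA => ?_) hm
  · simpa only [div_one, mul_one] using bound
  · simp only [div_one, mul_one]
    refine tsum_int_rpow_neg_le_five_mul ?_ (by linarith)
    push_cast
    linarith [k.cast_nonneg (α := ℝ)]

lemma tsum_notMem_indexBox_rpow_neg_le_Gamma_div {n : ℕ} {ν A₀ : ℝ} (hν : 0 < ν) (hA₀ : 0 ≤ A₀)
    (hνA₀ : √(ν + (n + 1 : ℕ) / 2) ≤ (5 - √π) * √(A₀ + 1)) {m : ℕ} (hm : 1 ≤ m) :
    ∑' j : {j : Fin (n + 1) → ℤ // j ∉ indexBox (n + 1) m},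
        ENNReal.ofReal ((A₀ + ∑ i, (j.1 i : ℝ) ^ 2) ^ (-(ν + (n + 1 : ℕ) / 2)))
      ≤ ENNReal.ofReal ((n + 1) * (5 ^ n * (Gamma (ν + 1 / 2) / Gamma (ν + (n + 1 : ℕ) / 2)))
        * ((m : ℝ) ^ (-(2 * ν)) / ν)) := by
  have bound := tsum_notMem_indexBox_rpow_neg_le_of_step (n := n) hν hA₀
    (g := fun k => Gamma (ν + (k + 1 : ℕ) / 2)) (fun k => Gamma_pos_of_pos (by positivity))
    (fun k hk A hA => ?_) hm
  · simpa only [zero_add, Nat.cast_one] using bound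
  · have sqrt_le : √(ν + (k + 1 : ℕ) / 2) ≤ (5 - √π) * √A := by
      have five_nonneg : 0 ≤ 5 - √π := by
        nlinarith [sqrt_nonneg π, sq_sqrt pi_pos.le, pi_le_four]
      calc √(ν + (k + 1 : ℕ) / 2) ≤ √(ν + (n + 1 : ℕ) / 2) := by gcongr
        _ ≤ (5 - √π) * √(A₀ + 1) := hνA₀
        _ ≤ (5 - √π) * √A := by gcongr
    have half_step : ν + ((k + 1 + 1 : ℕ) : ℝ) / 2 = ν + (k + 1 : ℕ) / 2 + 1 / 2 := by
      push_cast
      ring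
    rw [half_step]
    exact tsum_int_rpow_neg_le_five_mul_Gamma_div (by positivity) (by linarith) sqrt_le

/-! ### The truncation error -/

/-- The shift `a` for which `|Ĉ(jh)|` is proportional to `(a + |j|²) ^ (-(ν + d / 2))`. -/
noncomputable def fourierShift (ν ℓ h : ℝ) : ℝ :=
  ν / (2 * π ^ 2 * (ℓ * h) ^ 2)

/-- The constant `K` in `h ^ d * |Ĉ(jh)| = K * (a + |j|²) ^ (-(ν + d / 2))`, where `a` is
`fourierShift ν ℓ h`. -/
noncomputable def fourierDecayConst (d : ℕ) (ν ℓ h : ℝ) : ℝ :=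
  Gamma (ν + d / 2) / Gamma ν * π ^ (-((d : ℝ) / 2)) * fourierShift ν ℓ h ^ ν

lemma fourierShift_pos {ν ℓ h : ℝ} (hν : 0 < ν) (hℓ : 0 < ℓ) (hh : 0 < h) :
    0 < fourierShift ν ℓ h := by
  unfold fourierShift
  positivity

lemma fourierDecayConst_nonneg {d : ℕ} {ν ℓ h : ℝ} (hν : 0 < ν) :
    0 ≤ fourierDecayConst d ν ℓ h := by
  unfold fourierDecayConst fourierShift
  positivity

lemma norm_latticePoint_sq {d : ℕ} (j : Fin d → ℤ) :
    ‖latticePoint j‖ ^ 2 = ∑ i, (j i : ℝ) ^ 2 :=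
  EuclideanSpace.real_norm_sq_eq _

lemma norm_truncTerm {d : ℕ} {ν ℓ h : ℝ} (hν : 0 < ν) (hℓ : 0 < ℓ)
    (x : EuclideanSpace ℝ (Fin d)) (j : Fin d → ℤ) :
    ‖truncTerm ν ℓ h x j‖ = Gamma (ν + d / 2) / Gamma ν * (2 * π * ℓ ^ 2 / ν) ^ ((d : ℝ) / 2)
      * (1 + 2 * π ^ 2 * ℓ ^ 2 / ν * (h ^ 2 * ∑ i, (j i : ℝ) ^ 2)) ^ (-(ν + d / 2)) := by
  have norm_exp : ‖Complex.exp (2 * π * Complex.I * h * (inner ℝ (latticePoint j) x : ℝ))‖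
      = 1 := by
    rw [show (2 * π * Complex.I * h * (inner ℝ (latticePoint j) x : ℝ) : ℂ)
      = ((2 * π * h * inner ℝ (latticePoint j) x : ℝ) : ℂ) * Complex.I by push_cast; ring,
      Complex.norm_exp_ofReal_mul_I]
  rw [truncTerm, norm_mul, norm_exp, mul_one, maternHat_eq hν hℓ, Complex.norm_real,
    norm_of_nonneg (by positivity), norm_smul, mul_pow, norm_latticePoint_sq, norm_eq_abs, sq_abs]

lemma pow_mul_norm_truncTerm {d : ℕ} {ν ℓ h : ℝ} (hν : 0 < ν) (hℓ : 0 < ℓ) (hh : 0 < h)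
    (x : EuclideanSpace ℝ (Fin d)) (j : Fin d → ℤ) :
    h ^ d * ‖truncTerm ν ℓ h x j‖ = fourierDecayConst d ν ℓ h
      * (fourierShift ν ℓ h + ∑ i, (j i : ℝ) ^ 2) ^ (-(ν + d / 2)) := by
  have shift_pos := fourierShift_pos hν hℓ hh
  rw [norm_truncTerm hν hℓ, fourierDecayConst]
  set S := ∑ i, (j i : ℝ) ^ 2
  set a := fourierShift ν ℓ h with ha
  have : 0 ≤ S := Finset.sum_nonneg fun _ _ => sq_nonneg _
  have factor : 1 + 2 * π ^ 2 * ℓ ^ 2 / ν * (h ^ 2 * S) = a⁻¹ * (a + S) := by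
    rw [mul_add, inv_mul_cancel₀ shift_pos.ne', ha, fourierShift, inv_div]
    ring
  have volume_factor : h ^ d * (2 * π * ℓ ^ 2 / ν) ^ ((d : ℝ) / 2)
      = π ^ (-((d : ℝ) / 2)) * a ^ (-((d : ℝ) / 2)) := by
    have pow_eq : h ^ d = (h ^ 2) ^ ((d : ℝ) / 2) := by
      rw [← rpow_natCast, ← rpow_two, ← rpow_mul hh.le, mul_div_cancel₀ _ two_ne_zero]
    rw [pow_eq, ← mul_rpow (by positivity) (by positivity),
      ← mul_rpow (by positivity) (by positivity), rpow_neg (by positivity),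
      ← inv_rpow (by positivity), ha, fourierShift]
    congr 1
    field_simp
  calc h ^ d * (Gamma (ν + d / 2) / Gamma ν * (2 * π * ℓ ^ 2 / ν) ^ ((d : ℝ) / 2)
        * (1 + 2 * π ^ 2 * ℓ ^ 2 / ν * (h ^ 2 * S)) ^ (-(ν + d / 2)))
      = Gamma (ν + d / 2) / Gamma ν * (h ^ d * (2 * π * ℓ ^ 2 / ν) ^ ((d : ℝ) / 2))
        * (a⁻¹ * (a + S)) ^ (-(ν + d / 2)) := by
        rw [factor]
        ring
    _ = Gamma (ν + d / 2) / Gamma ν * π ^ (-((d : ℝ) / 2))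
        * (a ^ (-((d : ℝ) / 2)) * a ^ (ν + d / 2)) * (a + S) ^ (-(ν + d / 2)) := by
        rw [volume_factor, mul_rpow (by positivity) (by positivity), inv_rpow shift_pos.le,
          rpow_neg shift_pos.le (ν + d / 2), inv_inv]
        ring
    _ = _ := by
        rw [← rpow_add shift_pos]
        ring_nf

lemma truncTerm_summable_and_norm_tsum_le {d : ℕ} {ν ℓ h B : ℝ} (hν : 0 < ν) (hℓ : 0 < ℓ)
    (hh : 0 < h) (hB : 0 ≤ B) {S : Set (Fin d → ℤ)}
    (hS : ∑' j : {j // j ∉ S}, ENNReal.ofReal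
      ((fourierShift ν ℓ h + ∑ i, (j.1 i : ℝ) ^ 2) ^ (-(ν + d / 2))) ≤ ENNReal.ofReal B)
    (x : EuclideanSpace ℝ (Fin d)) :
    Summable (fun j : {j // j ∉ S} => truncTerm ν ℓ h x j) ∧
      ‖(h : ℂ) ^ d * ∑' j : {j // j ∉ S}, truncTerm ν ℓ h x j‖
        ≤ fourierDecayConst d ν ℓ h * B := by
  have const_nonneg : 0 ≤ fourierDecayConst d ν ℓ h := fourierDecayConst_nonneg hν
  have pow_ne_zero : (h : ℂ) ^ d ≠ 0 := pow_ne_zero _ (Complex.ofReal_ne_zero.2 hh.ne')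
  rw [← tsum_mul_left, ← summable_mul_left_iff pow_ne_zero]
  refine summable_and_norm_tsum_le (mul_nonneg const_nonneg hB) ?_
  simp only [norm_mul, norm_pow, Complex.norm_real, norm_of_nonneg hh.le,
    pow_mul_norm_truncTerm hν hℓ hh, ENNReal.ofReal_mul const_nonneg, ENNReal.tsum_mul_left]
  gcongr

lemma fourierDecayConst_mul_rpow {d : ℕ} {ν ℓ h M : ℝ} (hν : 0 < ν) (hℓ : 0 < ℓ) (hh : 0 < h)
    (hM : 0 < M) :
    fourierDecayConst d ν ℓ h * (M ^ (-(2 * ν)) / ν)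
      = ν ^ (ν - 1) / (2 ^ ν * π ^ ((d : ℝ) / 2 + 2 * ν)) * (Gamma (ν + d / 2) / Gamma ν)
        * (1 / (h * ℓ * M) ^ (2 * ν)) := by
  have shift_rpow : fourierShift ν ℓ h ^ ν
      = ν ^ ν / (2 ^ ν * π ^ (2 * ν) * (h * ℓ) ^ (2 * ν)) := by
    rw [fourierShift, div_rpow hν.le (by positivity), mul_rpow (by positivity) (by positivity),
      mul_rpow (by positivity) (by positivity), rpow_mul pi_pos.le,
      rpow_mul (by positivity : 0 ≤ h * ℓ), rpow_two, rpow_two, mul_comm ℓ h]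
  rw [fourierDecayConst, shift_rpow, rpow_neg pi_pos.le, rpow_neg hM.le,
    mul_rpow (by positivity : 0 ≤ h * ℓ) hM.le, rpow_add pi_pos, rpow_sub_one hν.ne']
  field_simp

lemma sqrt_le_five_sub_sqrt_pi_mul_sqrt {s A : ℝ} (hA : 0 ≤ A) (h : s ≤ 10.4 * A) :
    √s ≤ (5 - √π) * √A := by
  have sqrt_pi_le : √π ≤ 1.775 := sqrt_le_iff.2 ⟨by norm_num, by nlinarith [pi_lt_d4]⟩
  calc √s ≤ √(3.225 ^ 2 * A) := sqrt_le_sqrt (by nlinarith)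
    _ = 3.225 * √A := by rw [sqrt_mul (by norm_num), sqrt_sq (by norm_num)]
    _ ≤ (5 - √π) * √A := by
        gcongr
        linarith

lemma inv_sq_add_le_inv_mul_sq {ν ℓ h : ℝ} (hν : 0 ≤ ν) (hℓ : 0 < ℓ)
    (hh : 1 + √(8 * ν) * ℓ ≤ h⁻¹) : ℓ⁻¹ ^ 2 + 8 * ν ≤ (ℓ * h)⁻¹ ^ 2 :=
  calc ℓ⁻¹ ^ 2 + 8 * ν = ℓ⁻¹ ^ 2 + √(8 * ν) ^ 2 := by rw [sq_sqrt (by positivity)]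
    _ ≤ (ℓ⁻¹ + √(8 * ν)) ^ 2 := by
        rw [add_sq]
        linarith [show 0 ≤ 2 * ℓ⁻¹ * √(8 * ν) by positivity]
    _ = (ℓ⁻¹ * (1 + √(8 * ν) * ℓ)) ^ 2 := by field_simp
    _ ≤ (ℓ⁻¹ * h⁻¹) ^ 2 := by gcongr
    _ = (ℓ * h)⁻¹ ^ 2 := by rw [mul_inv]

lemma add_half_dim_le_mul_fourierShift_add_one {d : ℕ} {ν ℓ h : ℝ} (hd : 0 < d) (hν : 0 < ν)
    (hℓ : 0 < ℓ) (hlog : log 2 ≤ √(ν / (2 * d)) / ℓ) (hh : 1 + √(8 * ν) * ℓ ≤ h⁻¹) :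
    ν + d / 2 ≤ 10.4 * (fourierShift ν ℓ h + 1) := by
  have d_pos : (0 : ℝ) < d := Nat.cast_pos.2 hd
  have log_sq : 0.4803 ≤ log 2 ^ 2 := by nlinarith [log_two_gt_d9]
  have pi_sq : 2 * π ^ 2 ≤ 19.74 := by nlinarith [pi_lt_d4, pi_pos]
  have inv_sq : log 2 ^ 2 * (2 * d) ≤ ν * ℓ⁻¹ ^ 2 := by
    have sq_le := pow_le_pow_left₀ (log_nonneg one_le_two) hlog 2
    rw [div_pow, sq_sqrt (by positivity)] at sq_le
    calc log 2 ^ 2 * (2 * d) ≤ ν / (2 * d) / ℓ ^ 2 * (2 * d) := by gcongr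
      _ = ν * ℓ⁻¹ ^ 2 := by field_simp
  have shift_ge : 0.9606 * d + 8 * ν ^ 2 ≤ 19.74 * fourierShift ν ℓ h :=
    calc 0.9606 * d + 8 * ν ^ 2 ≤ log 2 ^ 2 * (2 * d) + 8 * ν ^ 2 := by
          gcongr ?_ + _
          nlinarith
      _ ≤ ν * (ℓ⁻¹ ^ 2 + 8 * ν) := by linarith
      _ ≤ ν * (ℓ * h)⁻¹ ^ 2 := by
          gcongr
          exact inv_sq_add_le_inv_mul_sq hν.le hℓ hh
      _ = 2 * π ^ 2 * fourierShift ν ℓ h := by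
          rw [fourierShift]
          field_simp
      _ ≤ 19.74 * fourierShift ν ℓ h := by
          gcongr
          unfold fourierShift
          positivity
  nlinarith [sq_nonneg (ν - 1)]

lemma truncTerm_summable_and_norm_tsum_notMem_indexBox_le {n m : ℕ} {ν ℓ h C : ℝ} (hν : 0 < ν)
    (hℓ : 0 < ℓ) (hh : 0 < h) (hC : 0 ≤ C) (hm : 1 ≤ m)
    (hbox : ∑' j : {j : Fin (n + 1) → ℤ // j ∉ indexBox (n + 1) m}, ENNReal.ofReal
      ((fourierShift ν ℓ h + ∑ i, (j.1 i : ℝ) ^ 2) ^ (-(ν + (n + 1 : ℕ) / 2)))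
      ≤ ENNReal.ofReal ((n + 1) * (5 ^ n * C) * ((m : ℝ) ^ (-(2 * ν)) / ν)))
    (x : EuclideanSpace ℝ (Fin (n + 1))) :
    Summable (fun j : {j // j ∉ indexBox (n + 1) m} => truncTerm ν ℓ h x j) ∧
      ‖(h : ℂ) ^ (n + 1) * ∑' j : {j // j ∉ indexBox (n + 1) m}, truncTerm ν ℓ h x j‖
        ≤ ν ^ (ν - 1) * (n + 1 : ℕ) * 5 ^ n / (2 ^ ν * π ^ (((n + 1 : ℕ) : ℝ) / 2 + 2 * ν))
          * (Gamma (ν + (n + 1 : ℕ) / 2) * C / Gamma ν) * (1 / (h * ℓ * m) ^ (2 * ν)) := by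
  have m_pos : (0 : ℝ) < m := Nat.cast_pos.2 hm
  obtain ⟨summable, norm_le⟩ :=
    truncTerm_summable_and_norm_tsum_le hν hℓ hh (by positivity) hbox x
  refine ⟨summable, norm_le.trans_eq ?_⟩
  rw [mul_left_comm, fourierDecayConst_mul_rpow hν hℓ hh m_pos, Nat.cast_succ]
  ring

theorem theorem4p4_general (d : ℕ) (hd : 1 ≤ d) (ν ℓ h : ℝ) (hν : 0 < ν)
    (hℓ0 : 0 < ℓ) (hℓ : ℓ ≤ (log 2)⁻¹ * √(ν / (2 * d)))
    (hh0 : 0 < h) (hh : h ≤ (1 + √(8 * ν) * ℓ)⁻¹) :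
    (∀ x : EuclideanSpace ℝ (Fin d), (∀ i, x i ∈ Icc (-1 : ℝ) 1) →
      Summable (fun n : {n : Fin d → ℤ // n ≠ 0} => aliasTerm ν ℓ h x n) ∧
      |∑' n : {n : Fin d → ℤ // n ≠ 0}, aliasTerm ν ℓ h x n| ≤
        4 * d * 3 ^ (d - 1)
          * (2 ^ (1 - ν) / Gamma ν * (4 * ν) ^ ν * exp (2 * ν) * besselK ν (4 * ν))
          * exp (-(√(ν / (2 * d)) * ((h⁻¹ - 1) / ℓ)))) ∧
    Integrable (fun x : EuclideanSpace ℝ (Fin d) => (matern ν ℓ x : ℂ)) ∧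
    (∀ m : ℕ, 1 ≤ m → ∀ x : EuclideanSpace ℝ (Fin d),
      Summable (fun j : {j : Fin d → ℤ // j ∉ indexBox d m} => truncTerm ν ℓ h x j) ∧
      ‖(h : ℂ) ^ d * ∑' j : {j : Fin d → ℤ // j ∉ indexBox d m}, truncTerm ν ℓ h x j‖ ≤
        ν ^ (ν - 1) * d * 5 ^ (d - 1) / (2 ^ ν * π ^ ((d : ℝ) / 2 + 2 * ν))
          * (Gamma (ν + 1 / 2) / Gamma ν)
          * (1 / (h * ℓ * m) ^ (2 * ν)) ∧
      ‖(h : ℂ) ^ d * ∑' j : {j : Fin d → ℤ // j ∉ indexBox d m}, truncTerm ν ℓ h x j‖ ≤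
        ν ^ (ν - 1) * d * 5 ^ (d - 1) / (2 ^ ν * π ^ ((d : ℝ) / 2 + 2 * ν))
          * (Gamma (ν + (d : ℝ) / 2) / Gamma ν)
          * (1 / (h * ℓ * m) ^ (2 * ν))) := by
  obtain ⟨n, rfl⟩ : ∃ n, d = n + 1 := Nat.exists_eq_add_of_le' hd
  have period_ge : 1 + √(8 * ν) * ℓ ≤ h⁻¹ := (le_inv_comm₀ hh0 (by positivity)).1 hh
  have log_le : log 2 ≤ √(ν / (2 * (n + 1 : ℕ))) / ℓ := by
    rwa [le_div_iff₀ hℓ0, ← le_inv_mul_iff₀ (log_pos one_lt_two)]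
  have shift_pos := fourierShift_pos hν hℓ0 hh0
  have Gamma_pos : 0 < Gamma (ν + (n + 1 : ℕ) / 2) := Gamma_pos_of_pos (by positivity)
  rw [Nat.add_sub_cancel]
  refine ⟨fun x hx => ?_, integrable_matern hν hℓ0, fun m hm x => ?_⟩
  · obtain ⟨summable, error_le⟩ :=
      aliasTerm_summable_and_abs_tsum_le hν hℓ0 period_ge log_le fun i => abs_le.2 (hx i)
    refine ⟨summable, error_le.trans_eq ?_⟩
    rw [maternDecayConst, div_mul_eq_mul_div, ← mul_div_assoc, Nat.cast_succ]
    ring_nf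
  · obtain ⟨summable, Gamma_half_bound⟩ := truncTerm_summable_and_norm_tsum_notMem_indexBox_le
      hν hℓ0 hh0 (by positivity) hm
      (tsum_notMem_indexBox_rpow_neg_le_Gamma_div hν shift_pos.le
        (sqrt_le_five_sub_sqrt_pi_mul_sqrt (by positivity)
          (add_half_dim_le_mul_fourierShift_add_one hd hν hℓ0 log_le period_ge)) hm) x
    obtain ⟨-, Gamma_dim_bound⟩ := truncTerm_summable_and_norm_tsum_notMem_indexBox_le
      hν hℓ0 hh0 zero_le_one hm
      (by simpa only [mul_one] using tsum_notMem_indexBox_rpow_neg_le hν shift_pos.le hm) x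
    rw [mul_div_cancel₀ _ Gamma_pos.ne'] at Gamma_half_bound
    rw [mul_one] at Gamma_dim_bound
    exact ⟨summable, Gamma_half_bound, Gamma_dim_bound⟩

theorem theorem4p4 (d : ℕ) (hd : 1 ≤ d) (ν ℓ h : ℝ) (hν : 1 / 2 ≤ ν)
    (hℓ0 : 0 < ℓ) (hℓ : ℓ ≤ (Real.log 2)⁻¹ * Real.sqrt (ν / (2 * d)))
    (hh0 : 0 < h) (hh : h ≤ (1 + Real.sqrt (8 * ν) * ℓ)⁻¹) :
    -- aliasing error, uniformly on `[-1,1]^d`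
    (∀ x : EuclideanSpace ℝ (Fin d), (∀ i, x i ∈ Set.Icc (-1 : ℝ) 1) →
      Summable (fun n : {n : Fin d → ℤ // n ≠ 0} => aliasTerm ν ℓ h x n) ∧
      |∑' n : {n : Fin d → ℤ // n ≠ 0}, aliasTerm ν ℓ h x n| ≤
        4 * d * 3 ^ (d - 1)
          * (2 ^ (1 - ν) / Real.Gamma ν * (4 * ν) ^ ν * Real.exp (2 * ν) * besselK ν (4 * ν))
          * Real.exp (-(Real.sqrt (ν / (2 * d)) * ((h⁻¹ - 1) / ℓ)))) ∧
    -- the Fourier transform of the kernel is an absolutely convergent integral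
    MeasureTheory.Integrable
      (fun x : EuclideanSpace ℝ (Fin d) => (matern ν ℓ x : ℂ)) ∧
    -- truncation error, uniformly on `ℝ^d`
    (∀ m : ℕ, 1 ≤ m → ∀ x : EuclideanSpace ℝ (Fin d),
      Summable (fun j : {j : Fin d → ℤ // j ∉ indexBox d m} => truncTerm ν ℓ h x j) ∧
      ‖(h : ℂ) ^ d * ∑' j : {j : Fin d → ℤ // j ∉ indexBox d m}, truncTerm ν ℓ h x j‖ ≤
        ν ^ (ν - 1) * d * 5 ^ (d - 1) / (2 ^ ν * Real.pi ^ ((d : ℝ) / 2 + 2 * ν))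
          * (Real.Gamma (ν + 1 / 2) / Real.Gamma ν)
          * (1 / (h * ℓ * m) ^ (2 * ν)) ∧
      ‖(h : ℂ) ^ d * ∑' j : {j : Fin d → ℤ // j ∉ indexBox d m}, truncTerm ν ℓ h x j‖ ≤
        ν ^ (ν - 1) * d * 5 ^ (d - 1) / (2 ^ ν * Real.pi ^ ((d : ℝ) / 2 + 2 * ν))
          * (Real.Gamma (ν + (d : ℝ) / 2) / Real.Gamma ν)
          * (1 / (h * ℓ * m) ^ (2 * ν))) :=
  theorem4p4_general d hd ν ℓ h (by linarith) hℓ0 hℓ hh0 hh
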